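/- Let $\mathbf 1=(1,1,1,1)^T$ and let $e_i\in\mathbb R^4$ ($1\le i\le 3$) be the column whose first $i$ entries are $1$ and whose other entries are $0$. For columns $x,y,u,v$ of length $4$ let $\mathrm{per}[x,y,u,v]$ be the permanent of the $4\times4$ matrix with these columns. In the variables $X=(a,b,c,d,a',b',c',d')$ let $$x=(a+b^2+c^2+d^2,\;a+c^2+d^2,\;a+d^2,\;a)^T,\qquad y=(a'+b'^2+c'^2+d'^2,\;a'+c'^2+d'^2,\;a'+d'^2,\;a')^T$$ (generic weakly decreasing real columns), and for $i,j\in\{1,2,3\}$ define the polynomials arising from the Monotone Column Permanent (MCP) conjecture in dimension $4$ by $$p_{i,j}=\mathrm{per}[x,y,e_i,\mathbf 1]\;\mathrm{per}[x,y,e_j,\mathbf 1]-\mathrm{per}[x,y,\mathbf 1,\mathbf 1]\;\mathrm{per}[x,y,e_i,e_j]\in\mathbb Q[X].$$ For $f\in\mathbb R[X]$ let $\mathcal G_f$ be the set of terms $X^\alpha$ such that $2\alpha$ lies in the convex hull of $\{\beta : X^\beta\in\mathrm{supp}(f)\}$, and let $m_f$ be the number of terms in $\mathcal G_f\cdot\mathcal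 G_f=\{X^{\alpha+\beta} : X^\alpha,X^\beta\in\mathcal G_f\}$. A rational Farkas certificate for $f$ is a vector $\hat y\in\mathbb Q^{m_f}$, indexed by the terms in $\mathcal G_f\cdot\mathcal G_f$ and extended by zero to all terms, whose linear form $L_{\hat y}(g)=\sum_\alpha \hat y_\alpha g_\alpha$ satisfies $L_{\hat y}(u^2)\ge 0$ for every $u\in\mathbb R[X]$ with $\mathrm{supp}(u)\subseteq\mathcal G_f$, and $L_{\hat y}(f)<0$. Then each of $p_{1,2}$, $p_{2,2}$, $p_{2,3}$ is a polynomial of degree $8$ in the $8$ variables $X$, has a rational Farkas certificate, and is not a sum of squares of polynomials in $\mathbb R[X]$. Consequently non-constant denominators are necessary: none of the three can be written as $\sum_i u_i^2/\sum_j v_j^2$ with $u_i\in\mathbb R[X]$ and real constants $v_j$, $\sum_j v_j^2\ne 0$. Moreover, the block matrices of the corresponding semidefinite programs, whose order is $\#\mathcal G_f+1$, have order $24$, $29$, $39$ for $f=p_{1,2},p_{2,2},p_{2,3}$, and the certificate lengths $m_f$ are $189$, $255$, $372$, respectively. -/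

import Mathlib

open scoped Pointwise

noncomputable section

/-! ### The polynomials from the Monotone Column Permanent conjecture in dimension 4 -/

/-- A weakly decreasing column of length `4`: its last entry is `a`, and the gaps between
consecutive entries are the squares `b ^ 2`, `c ^ 2`, `d ^ 2`. -/
def mcpColumn {R : Type*} [CommRing R] (a b c d : R) : Fin 4 → R :=
  ![a + b ^ 2 + c ^ 2 + d ^ 2, a + c ^ 2 + d ^ 2, a + d ^ 2, a]

/-- The `0/1`-column of length `4` whose first `i` entries are `1`; the all-ones column is
`mcpStep R 4`. -/
def mcpStep (R : Type*) [CommRing R] (i : ℕ) : Fin 4 → R :=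
  fun r => if (r : ℕ) < i then 1 else 0

/-- The permanent of the `4 × 4` matrix with columns `x`, `y`, `u`, `v`. -/
def mcpPerm {R : Type*} [CommRing R] (x y u v : Fin 4 → R) : R :=
  (Matrix.of fun r : Fin 4 => ![x r, y r, u r, v r]).permanent

/-- Write `1` for the all-ones column and `e i` for the column whose first `i` entries are `1`.
The value is `per[x,y,eᵢ,1] * per[x,y,eⱼ,1] - per[x,y,1,1] * per[x,y,eᵢ,eⱼ]`, that is
`∂₁F * ∂₂F - F * ∂₁∂₂F` for the polynomial
`F(z₁, z₂) = per[x, y, z₁ • 1 + eᵢ, z₂ • 1 + eⱼ]`. -/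
def mcpForm {R : Type*} [CommRing R] (i j : ℕ) (x y : Fin 4 → R) : R :=
  mcpPerm x y (mcpStep R i) (mcpStep R 4) * mcpPerm x y (mcpStep R j) (mcpStep R 4)
    - mcpPerm x y (mcpStep R 4) (mcpStep R 4) * mcpPerm x y (mcpStep R i) (mcpStep R j)

open MvPolynomial in
/-- The polynomial `p_{i,j}` in `8` variables: `mcpForm i j` at two generic weakly decreasing
real columns. -/
def mcpPoly (i j : ℕ) : MvPolynomial (Fin 8) ℝ :=
  mcpForm i j (mcpColumn (X 0) (X 1) (X 2) (X 3)) (mcpColumn (X 4) (X 5) (X 6) (X 7))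

/-! ### Sums of squares, Hilbert-Artin representations, Farkas certificates

Terms are identified with their exponent vectors `α : Fin n →₀ ℕ`. -/

/-- The set of terms of total degree at most `e` in `n` variables. -/
def termsLE (n e : ℕ) : Set (Fin n →₀ ℕ) := {α | α.degree ≤ e}

/-- The rational functions `∑ uᵢ² / ∑ vⱼ²` (with `∑ vⱼ² ≠ 0`) where `uᵢ`, `vⱼ` are real
polynomials and all terms of every `vⱼ` lie in `T`. -/
def RSOS {n : ℕ} (T : Set (Fin n →₀ ℕ)) : Set (FractionRing (MvPolynomial (Fin n) ℝ)) :=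
  {r | ∃ (l l' : ℕ) (u : Fin l → MvPolynomial (Fin n) ℝ) (v : Fin l' → MvPolynomial (Fin n) ℝ),
    (∀ j, (↑(v j).support : Set (Fin n →₀ ℕ)) ⊆ T) ∧ ∑ j, v j ^ 2 ≠ 0 ∧
    r = algebraMap _ (FractionRing (MvPolynomial (Fin n) ℝ)) (∑ i, u i ^ 2) /
        algebraMap _ (FractionRing (MvPolynomial (Fin n) ℝ)) (∑ j, v j ^ 2)}

/-- The exponent vector `α` as a point of `ℝⁿ`. -/
def expPoint {n : ℕ} (α : Fin n →₀ ℕ) : Fin n → ℝ := fun i => (α i : ℝ)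

/-- The sparse set `𝒢_{f,T}` of terms: all `α` such that `2 α` lies in the convex hull of the
exponents `β + γ₁ + γ₂` with `β` in the support of `f` and `γ₁, γ₂ ∈ T`. -/
def sparseTerms {n : ℕ} (f : MvPolynomial (Fin n) ℝ) (T : Set (Fin n →₀ ℕ)) :
    Set (Fin n →₀ ℕ) :=
  {α | expPoint (2 • α) ∈
    convexHull ℝ (expPoint '' ((↑f.support : Set (Fin n →₀ ℕ)) + T + T))}

/-- The linear form `L_y` on polynomials attached to a vector `y` of rational numbers indexed by
terms: `L_y(f) = ∑_α f_α y_α`. -/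
def momentForm {n : ℕ} (y : (Fin n →₀ ℕ) → ℚ) (f : MvPolynomial (Fin n) ℝ) : ℝ :=
  ∑ α ∈ f.support, f.coeff α * (y α : ℝ)

/-- `y` is a rational Farkas certificate (in sparse form) that `f` has no Hilbert-Artin
representation with denominator terms in `T`: with `G = 𝒢_{f,T}`, it is a vector indexed by the
terms in `G + G` (it is zero elsewhere), `L_y(u²) ≥ 0` whenever all terms of `u` lie in `G`, and
`L_y(f v²) < 0` for every nonzero `v` all of whose terms lie in `T`. -/
def IsFarkasCertificate {n : ℕ} (f : MvPolynomial (Fin n) ℝ) (T : Set (Fin n →₀ ℕ))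
    (y : (Fin n →₀ ℕ) → ℚ) : Prop :=
  Function.support y ⊆ sparseTerms f T + sparseTerms f T ∧
  (∀ u : MvPolynomial (Fin n) ℝ, (↑u.support : Set (Fin n →₀ ℕ)) ⊆ sparseTerms f T →
    0 ≤ momentForm y (u ^ 2)) ∧
  (∀ v : MvPolynomial (Fin n) ℝ, v ≠ 0 → (↑v.support : Set (Fin n →₀ ℕ)) ⊆ T →
    momentForm y (f * v ^ 2) < 0)

/-- The order of the block matrices in the semidefinite program for `f` and `T` after sparsity
has been exploited: one block indexed by `𝒢_{f,T}` and one indexed by `T`. -/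
def sdpDim {n : ℕ} (f : MvPolynomial (Fin n) ℝ) (T : Set (Fin n →₀ ℕ)) : ℕ :=
  (sparseTerms f T).ncard + T.ncard

/-- The number of terms that index a sparse Farkas certificate, `#(𝒢_{f,T} + 𝒢_{f,T})`. -/
def certificateLength {n : ℕ} (f : MvPolynomial (Fin n) ℝ) (T : Set (Fin n →₀ ℕ)) : ℕ :=
  (sparseTerms f T + sparseTerms f T).ncard

end

/-! If `f = ∑ uᵢ²`, a vertex of the hull of all exponents of the `uᵢ` doubles to an exponent of `f`,
because its coefficient there is a sum of squares and cannot cancel. Hence every `uᵢ` has its terms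
in half the Newton polytope (`expPoint_mem_of_eq_sum_sq`), and a linear form that is nonnegative on
such squares but negative at `f` rules out the representation. Constant denominators change nothing,
since a positive constant has a square root.

The form is built from a few integer vectors `v_k` with `y (α + β) = ∑ v_k α * v_k β`, so that
`L(u²)` is visibly a sum of squares (`momentForm_sq_nonneg`). The half polytope is enclosed by
bihomogeneity and at most two further inequalities; conversely, the double of each remaining term is
itself in the support (`sparseTerms_codedPoly`). With terms coded as decimal numbers, the remaining
checks are finite integer computations. -/

/-! ### The linear form of a vector of moments -/

section momentForm

variable {n : ℕ} (y : (Fin n →₀ ℕ) → ℚ)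

theorem momentForm_eq_sum {f : MvPolynomial (Fin n) ℝ} {s : Finset (Fin n →₀ ℕ)}
    (hs : f.support ⊆ s) : momentForm y f = ∑ α ∈ s, f.coeff α * (y α : ℝ) :=
  Finset.sum_subset hs fun α _ hα => by
    rw [MvPolynomial.notMem_support_iff.1 hα, zero_mul]

theorem momentForm_add (f g : MvPolynomial (Fin n) ℝ) :
    momentForm y (f + g) = momentForm y f + momentForm y g := by
  classical
  rw [momentForm_eq_sum y (f := f) (Finset.subset_union_left (s₂ := g.support)),
    momentForm_eq_sum y (f := g) (Finset.subset_union_right (s₁ := f.support)),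
    momentForm_eq_sum y (f := f + g) MvPolynomial.support_add, ← Finset.sum_add_distrib]
  simp only [MvPolynomial.coeff_add, add_mul]

theorem momentForm_smul (c : ℝ) (f : MvPolynomial (Fin n) ℝ) :
    momentForm y (c • f) = c * momentForm y f := by
  rw [momentForm_eq_sum y (MvPolynomial.support_smul (a := c) (f := f)), momentForm,
    Finset.mul_sum]
  simp only [MvPolynomial.coeff_smul, smul_eq_mul, mul_assoc]

/-- `momentForm` as a linear map. -/
noncomputable def momentLinear : MvPolynomial (Fin n) ℝ →ₗ[ℝ] ℝ where
  toFun := momentForm y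
  map_add' := momentForm_add y
  map_smul' := momentForm_smul y

theorem momentLinear_monomial (α : Fin n →₀ ℕ) (c : ℝ) :
    momentLinear y (MvPolynomial.monomial α c) = c * y α := by
  change momentForm y _ = _
  rw [momentForm_eq_sum y MvPolynomial.support_monomial_subset]
  simp

theorem momentForm_sq (u : MvPolynomial (Fin n) ℝ) :
    momentForm y (u ^ 2) =
      ∑ α ∈ u.support, ∑ β ∈ u.support, u.coeff α * u.coeff β * y (α + β) := by
  have h : u ^ 2 = ∑ α ∈ u.support, ∑ β ∈ u.support,
      MvPolynomial.monomial (α + β) (u.coeff α * u.coeff β) := by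
    conv_lhs => rw [u.as_sum, sq, Finset.sum_mul_sum]
    simp only [MvPolynomial.monomial_mul]
  change momentLinear y (u ^ 2) = _
  rw [h]
  simp only [map_sum, momentLinear_monomial]

/-- If the moments on `G + G` form a Gram matrix, then the linear form is nonnegative on squares
of polynomials with terms in `G`. -/
theorem momentForm_sq_nonneg {ι : Type*} (K : Finset ι) (v : ι → (Fin n →₀ ℕ) → ℝ)
    {u : MvPolynomial (Fin n) ℝ}
    (h : ∀ α ∈ u.support, ∀ β ∈ u.support, (y (α + β) : ℝ) = ∑ k ∈ K, v k α * v k β) :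
    0 ≤ momentForm y (u ^ 2) := by
  have h' : momentForm y (u ^ 2) = ∑ k ∈ K, (∑ α ∈ u.support, u.coeff α * v k α) ^ 2 := by
    simp_rw [momentForm_sq, sq, Finset.sum_mul_sum]
    rw [Finset.sum_comm (s := K)]
    refine Finset.sum_congr rfl fun α hα => ?_
    rw [Finset.sum_comm (s := K)]
    refine Finset.sum_congr rfl fun β hβ => ?_
    rw [h α hα β hβ, Finset.mul_sum]
    exact Finset.sum_congr rfl fun k _ => by ring
  rw [h']
  exact Finset.sum_nonneg fun k _ => sq_nonneg _

end momentForm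

/-! ### Sums of squares and Newton polytopes -/

theorem termsLE_zero (n : ℕ) : termsLE n 0 = {0} := by
  ext α
  simp [termsLE, Finsupp.degree_eq_zero_iff]

theorem sparseTerms_termsLE_zero {n : ℕ} (f : MvPolynomial (Fin n) ℝ) :
    sparseTerms f (termsLE n 0) =
      {α | expPoint (2 • α) ∈ convexHull ℝ (expPoint '' (f.support : Set (Fin n →₀ ℕ)))} := by
  simp [sparseTerms, termsLE_zero]

theorem expPoint_injective {n : ℕ} : Function.Injective (expPoint (n := n)) := fun α β h => by
  ext i
  exact Nat.cast_injective (R := ℝ) (congrFun h i)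

theorem expPoint_add {n : ℕ} (α β : Fin n →₀ ℕ) :
    expPoint (α + β) = expPoint α + expPoint β := by
  ext i
  simp [expPoint]

theorem IsSumSq.exists_sum_sq {R : Type*} [CommSemiring R] {a : R} (ha : IsSumSq a) :
    ∃ (l : ℕ) (u : Fin l → R), a = ∑ i, u i ^ 2 := by
  induction ha with
  | zero => exact ⟨0, Fin.elim0, by simp⟩
  | sq_add b _ ih =>
    obtain ⟨l, u, rfl⟩ := ih
    exact ⟨l + 1, Fin.cons b u, by simp [Fin.sum_univ_succ, sq]⟩

/-- Only the diagonal pair survives in the convolution. It is applied with `γ` a vertex, where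
extremality kills all other pairs. -/
theorem coeff_add_self_sq {σ R : Type*} [CommSemiring R] {g : MvPolynomial σ R} {γ : σ →₀ ℕ}
    (h : ∀ β δ, β + δ = γ + γ → β ≠ γ → g.coeff β * g.coeff δ = 0) :
    (g ^ 2).coeff (γ + γ) = g.coeff γ ^ 2 := by
  classical
  rw [sq, MvPolynomial.coeff_mul, Finset.sum_eq_single (γ, γ), sq]
  · rintro ⟨β, δ⟩ hx hne
    have hsum : β + δ = γ + γ := by simpa using hx
    refine h β δ hsum fun hβ => hne ?_
    subst hβ
    rw [add_left_cancel hsum]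
  · exact fun hx => absurd (by simp) hx

/-- The terms of the summands of a sum of squares `f` lie in half of the Newton polytope
of `f`. -/
theorem expPoint_mem_of_eq_sum_sq {n l : ℕ} (f : MvPolynomial (Fin n) ℝ)
    (u : Fin l → MvPolynomial (Fin n) ℝ) (hf : f = ∑ i, u i ^ 2) (i : Fin l) {α : Fin n →₀ ℕ}
    (hα : α ∈ (u i).support) :
    expPoint (2 • α) ∈ convexHull ℝ (expPoint '' (f.support : Set (Fin n →₀ ℕ))) := by
  classical
  set S : Finset (Fin n →₀ ℕ) := Finset.univ.biUnion fun j => (u j).support with hS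
  have hmem : ∀ j, ∀ β, (u j).coeff β ≠ 0 → β ∈ S := fun j β h =>
    Finset.mem_biUnion.2 ⟨j, Finset.mem_univ _, MvPolynomial.mem_support_iff.2 h⟩
  set P : Set (Fin n → ℝ) := convexHull ℝ (expPoint '' (S : Set (Fin n →₀ ℕ))) with hP
  have hfin : (expPoint '' (S : Set (Fin n →₀ ℕ))).Finite := S.finite_toSet.image _
  have hext : P.extremePoints ℝ ⊆ expPoint '' (S : Set (Fin n →₀ ℕ)) :=
    extremePoints_convexHull_subset
  -- Krein–Milman; the closure is superfluous because there are finitely many extreme points.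
  have hKM : convexHull ℝ (P.extremePoints ℝ) = P := by
    have h1 := closure_convexHull_extremePoints (hfin.isCompact_convexHull ℝ)
      (convex_convexHull ℝ _)
    rwa [((hfin.subset hext).isClosed_convexHull ℝ).closure_eq] at h1
  have hvert : ∀ p ∈ P.extremePoints ℝ, (2 : ℝ) • p ∈
      expPoint '' (f.support : Set (Fin n →₀ ℕ)) := by
    intro p hp
    obtain ⟨γ, hγ, rfl⟩ := hext hp
    refine ⟨γ + γ, ?_, by rw [expPoint_add, two_smul]⟩
    have hcoeff : f.coeff (γ + γ) = ∑ j, (u j).coeff γ ^ 2 := by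
      rw [hf, MvPolynomial.coeff_sum]
      refine Finset.sum_congr rfl fun j _ => coeff_add_self_sq fun β δ hsum hne => ?_
      by_contra hc
      have hβ := hmem j β (left_ne_zero_of_mul hc)
      have hδ := hmem j δ (right_ne_zero_of_mul hc)
      -- `β + δ = γ + γ` makes the vertex `γ` the midpoint of `β` and `δ`, which extremality forbids
      -- unless `β = γ`.
      have hseg : expPoint γ ∈ openSegment ℝ (expPoint β) (expPoint δ) := by
        refine ⟨1 / 2, 1 / 2, by norm_num, by norm_num, by norm_num, ?_⟩
        rw [← smul_add, ← expPoint_add, hsum, expPoint_add, ← two_smul ℝ, smul_smul]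
        norm_num
      exact hne (expPoint_injective ((mem_extremePoints_iff_left.1 hp).2 _
        (subset_convexHull ℝ _ ⟨β, hβ, rfl⟩) _ (subset_convexHull ℝ _ ⟨δ, hδ, rfl⟩) hseg))
    obtain ⟨j, -, hj⟩ := Finset.mem_biUnion.1 (Finset.mem_coe.1 hγ)
    refine MvPolynomial.mem_support_iff.2 (ne_of_gt ?_)
    rw [hcoeff]
    exact Finset.sum_pos' (fun _ _ => sq_nonneg _) ⟨j, Finset.mem_univ _,
      lt_of_le_of_ne (sq_nonneg _) (pow_ne_zero 2 (MvPolynomial.mem_support_iff.1 hj)).symm⟩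
  have hα' : expPoint α ∈ convexHull ℝ (P.extremePoints ℝ) := by
    rw [hKM]
    exact subset_convexHull ℝ _ ⟨α, hmem i α (MvPolynomial.mem_support_iff.1 hα), rfl⟩
  have h2 : (2 : ℝ) • expPoint α ∈ (2 : ℝ) • convexHull ℝ (P.extremePoints ℝ) :=
    Set.smul_mem_smul_set hα'
  rw [← convexHull_smul] at h2
  rw [two_smul ℕ, expPoint_add, ← two_smul ℝ]
  refine convexHull_mono ?_ h2
  rintro _ ⟨p, hp, rfl⟩
  exact hvert p hp

/-- A polynomial with a Farkas certificate (for constant denominators) is not a sum of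
squares. -/
theorem IsFarkasCertificate.not_isSumSq {n : ℕ} {f : MvPolynomial (Fin n) ℝ}
    {y : (Fin n →₀ ℕ) → ℚ} (hy : IsFarkasCertificate f (termsLE n 0) y) : ¬ IsSumSq f := by
  intro hf
  obtain ⟨l, u, hu⟩ := hf.exists_sum_sq
  -- The multiplier `1` turns the last certificate condition into `L(f) < 0`.
  have hneg := hy.2.2 1 one_ne_zero (by
    rw [termsLE_zero, ← MvPolynomial.C_1]
    intro α hα
    simpa [MvPolynomial.coeff_C, eq_comm] using hα)
  have hnonneg : 0 ≤ momentLinear y f := by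
    rw [hu, map_sum]
    refine Finset.sum_nonneg fun i _ => hy.2.1 _ fun α hα => ?_
    rw [sparseTerms_termsLE_zero]
    exact expPoint_mem_of_eq_sum_sq f u hu i hα
  rw [one_pow, mul_one] at hneg
  exact hneg.not_ge hnonneg

theorem eq_C_of_support_subset {n : ℕ} {v : MvPolynomial (Fin n) ℝ}
    (hv : (v.support : Set (Fin n →₀ ℕ)) ⊆ termsLE n 0) : ∃ c, v = MvPolynomial.C c := by
  refine ⟨v.coeff 0, MvPolynomial.totalDegree_eq_zero_iff_eq_C.1 ?_⟩
  rw [MvPolynomial.totalDegree_eq_zero_iff]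
  intro α hα i
  have h := hv hα
  rw [termsLE_zero] at h
  rw [Set.mem_singleton_iff.1 h]
  rfl

/-- A quotient of sums of squares with constant denominator is a sum of squares. -/
theorem isSumSq_of_mem_RSOS {n : ℕ} {f : MvPolynomial (Fin n) ℝ}
    (hf : algebraMap _ (FractionRing (MvPolynomial (Fin n) ℝ)) f ∈ RSOS (termsLE n 0)) :
    IsSumSq f := by
  obtain ⟨l, l', u, v, hv, hne, h⟩ := hf
  choose c hc using fun j => eq_C_of_support_subset (hv j)
  have hsum : ∑ j, v j ^ 2 = MvPolynomial.C (∑ j, c j ^ 2) := by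
    simp [hc]
  set s := ∑ j, c j ^ 2 with hs
  have hs0 : 0 ≤ s := Finset.sum_nonneg fun _ _ => sq_nonneg _
  rw [hsum] at hne
  have hs1 : s ≠ 0 := fun h0 => hne (by rw [h0, MvPolynomial.C_0])
  have hinj := IsFractionRing.injective (MvPolynomial (Fin n) ℝ)
    (FractionRing (MvPolynomial (Fin n) ℝ))
  rw [hsum, eq_div_iff (fun h0 => hne (hinj (by rw [h0, map_zero]))), ← map_mul] at h
  -- The constant denominator `s > 0` is absorbed into the squares through its real square root.
  have h1 : f = ∑ i, (MvPolynomial.C (√s)⁻¹ * u i) ^ 2 := by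
    have h2 := congrArg (· * MvPolynomial.C s⁻¹) (hinj h)
    simp only [mul_assoc, ← MvPolynomial.C_mul, mul_inv_cancel₀ hs1, MvPolynomial.C_1,
      mul_one] at h2
    rw [h2, mul_comm, Finset.mul_sum]
    refine Finset.sum_congr rfl fun i _ => ?_
    rw [mul_pow, ← MvPolynomial.C_pow, inv_pow, Real.sq_sqrt hs0]
  rw [h1]
  exact IsSumSq.sum fun i _ => (IsSquare.sq _).isSumSq

/-! ### Expansion of the polynomials -/

/-- Permutations of four points correspond to quadruples of distinct indices. The nested sums over
`Fin 4` can be expanded by `simp`. -/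
theorem mcpPerm_eq_sum {R : Type*} [CommRing R] (x y u v : Fin 4 → R) :
    mcpPerm x y u v = ∑ i, ∑ j, ∑ k, ∑ l,
      if i ≠ j ∧ i ≠ k ∧ i ≠ l ∧ j ≠ k ∧ j ≠ l ∧ k ≠ l then x i * y j * u k * v l else 0 := by
  have h : (Finset.univ : Finset (Equiv.Perm (Fin 4))).val.map
      (fun σ => (σ 0, σ 1, σ 2, σ 3)) =
      ((Finset.univ : Finset (Fin 4 × Fin 4 × Fin 4 × Fin 4)).filter fun p =>
        p.1 ≠ p.2.1 ∧ p.1 ≠ p.2.2.1 ∧ p.1 ≠ p.2.2.2 ∧ p.2.1 ≠ p.2.2.1 ∧ p.2.1 ≠ p.2.2.2 ∧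
          p.2.2.1 ≠ p.2.2.2).val := by
    decide +kernel
  have h' := congrArg (fun s => (s.map fun p : Fin 4 × Fin 4 × Fin 4 × Fin 4 =>
    x p.1 * y p.2.1 * u p.2.2.1 * v p.2.2.2).sum) h
  simp only [Multiset.map_map, Function.comp_def] at h'
  change ∑ σ : Equiv.Perm (Fin 4), x (σ 0) * y (σ 1) * u (σ 2) * v (σ 3) =
    ∑ p : Fin 4 × Fin 4 × Fin 4 × Fin 4 with _, x p.1 * y p.2.1 * u p.2.2.1 * v p.2.2.2 at h'
  rw [Finset.sum_filter] at h'
  simp only [Fintype.sum_prod_type] at h'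
  rw [← h']
  simp [mcpPerm, Matrix.permanent, Fin.prod_univ_four]

/-! ### Terms coded by decimal numbers

A term in `8` variables with exponents less than `10` is coded by the number whose decimal digits
are the exponents. -/

/-- The number whose decimal digits are the exponents of a term. -/
def termCode : (Fin 8 →₀ ℕ) →+ ℕ where
  toFun α := 10000000 * α 0 + 1000000 * α 1 + 100000 * α 2 + 10000 * α 3 + 1000 * α 4 +
    100 * α 5 + 10 * α 6 + α 7
  map_zero' := by simp
  map_add' α β := by simp only [Finsupp.add_apply]; ring

/-- The `i`-th exponent of the term with a given code. -/
def codeDigit (n : ℕ) (i : Fin 8) : ℕ := n / 10 ^ (7 - (i : ℕ)) % 10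

/-- The term with a given code. -/
noncomputable def ofTermCode (n : ℕ) : Fin 8 →₀ ℕ := Finsupp.equivFunOnFinite.symm (codeDigit n)

@[simp]
theorem ofTermCode_apply (n : ℕ) (i : Fin 8) : ofTermCode n i = codeDigit n i := rfl

theorem termCode_ofTermCode {n : ℕ} (hn : n < 10 ^ 8) : termCode (ofTermCode n) = n := by
  simp [termCode, codeDigit]
  omega

theorem ofTermCode_termCode {α : Fin 8 →₀ ℕ} (hα : ∀ i, α i < 10) :
    ofTermCode (termCode α) = α := by
  have h0 := hα 0
  have h1 := hα 1
  have h2 := hα 2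
  have h3 := hα 3
  have h4 := hα 4
  have h5 := hα 5
  have h6 := hα 6
  have h7 := hα 7
  ext i
  fin_cases i <;> simp [termCode, codeDigit] <;> omega

/-- The polynomial with a given list of term codes and integer coefficients. -/
noncomputable def codedPoly (L : List (ℕ × ℤ)) : MvPolynomial (Fin 8) ℝ :=
  (L.map fun p => MvPolynomial.monomial (ofTermCode p.1) (p.2 : ℝ)).sum

theorem monomial_ofTermCode (n : ℕ) (c : ℤ) :
    MvPolynomial.monomial (ofTermCode n) (c : ℝ) =
      (c : MvPolynomial (Fin 8) ℝ) * ∏ i, MvPolynomial.X i ^ codeDigit n i := by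
  rw [MvPolynomial.monomial_eq, Finsupp.prod_fintype _ _ (by simp)]
  simp

/-- No carries occur, so adding codes is adding exponents. -/
theorem ofTermCode_add {m n : ℕ} (hm : m < 10 ^ 8) (hn : n < 10 ^ 8)
    (h : ∀ i, codeDigit m i + codeDigit n i < 10) :
    ofTermCode (m + n) = ofTermCode m + ofTermCode n := by
  rw [← ofTermCode_termCode (α := ofTermCode m + ofTermCode n) (by simpa using h), map_add,
    termCode_ofTermCode hm, termCode_ofTermCode hn]

theorem coeff_codedPoly (L : List (ℕ × ℤ)) (β : Fin 8 →₀ ℕ) :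
    (codedPoly L).coeff β =
      ((L.map fun p => if ofTermCode p.1 = β then p.2 else 0).sum : ℤ) := by
  induction L with
  | nil => simp [codedPoly]
  | cons p L ih =>
    have h : codedPoly (p :: L) =
        MvPolynomial.monomial (ofTermCode p.1) (p.2 : ℝ) + codedPoly L := by
      simp [codedPoly]
    rw [h, MvPolynomial.coeff_add, ih, MvPolynomial.coeff_monomial]
    simp

/-- Positive coefficients cannot cancel, so the support is read off the list even if a code is
repeated. -/
theorem mem_support_codedPoly {L : List (ℕ × ℤ)} (hL : ∀ p ∈ L, 0 < p.2) {β : Fin 8 →₀ ℕ} :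
    β ∈ (codedPoly L).support ↔ ∃ p ∈ L, ofTermCode p.1 = β := by
  have hnonneg : ∀ x ∈ L.map fun p => if ofTermCode p.1 = β then p.2 else 0, 0 ≤ x := by
    intro x hx
    obtain ⟨p, hp, rfl⟩ := List.mem_map.1 hx
    split_ifs
    exacts [(hL p hp).le, le_rfl]
  rw [MvPolynomial.mem_support_iff, coeff_codedPoly, Int.cast_ne_zero]
  constructor
  · intro h
    by_contra! hne
    refine h (List.sum_eq_zero fun x hx => ?_)
    obtain ⟨p, hp, rfl⟩ := List.mem_map.1 hx
    exact if_neg (hne p hp)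
  · rintro ⟨p, hp, hβ⟩ h
    have h0 := List.all_zero_of_le_zero_le_of_sum_eq_zero hnonneg h
      (List.mem_map.2 ⟨p, hp, rfl⟩)
    rw [if_pos hβ] at h0
    exact (hL p hp).ne' h0

/-- The weights of a coded term in the two groups of variables, where `X 0` and `X 4` have
weight `2` and the other variables have weight `1`. -/
def codeWeight (n : ℕ) : ℕ × ℕ :=
  (2 * codeDigit n 0 + codeDigit n 1 + codeDigit n 2 + codeDigit n 3,
    2 * codeDigit n 4 + codeDigit n 5 + codeDigit n 6 + codeDigit n 7)

/-- A list of coefficients is positive and bihomogeneous of weight `(4, 4)`. -/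
def IsPositiveBihomogeneous (L : List (ℕ × ℤ)) : Prop :=
  ∀ p ∈ L, 0 < p.2 ∧ p.1 < 10 ^ 8 ∧ codeWeight p.1 = (4, 4)

instance (L : List (ℕ × ℤ)) : Decidable (IsPositiveBihomogeneous L) :=
  inferInstanceAs (Decidable (∀ p ∈ L, _))

/-- Every variable has weight at least `1` and the total weight is `8`, so the degree is at most
`8`. -/
theorem totalDegree_codedPoly {L : List (ℕ × ℤ)} (hL : IsPositiveBihomogeneous L)
    (h8 : ∃ p ∈ L, ∑ i, codeDigit p.1 i = 8) : (codedPoly L).totalDegree = 8 := by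
  have hsupp := fun β => mem_support_codedPoly (β := β) fun p hp => (hL p hp).1
  apply le_antisymm
  · refine Finset.sup_le fun β hβ => ?_
    obtain ⟨p, hp, rfl⟩ := (hsupp β).1 hβ
    have h := (hL p hp).2.2
    simp only [codeWeight, Prod.mk.injEq] at h
    rw [Finsupp.sum_fintype _ _ (by simp)]
    simp only [ofTermCode_apply, Fin.sum_univ_eight]
    omega
  · obtain ⟨p, hp, h⟩ := h8
    have hle := MvPolynomial.le_totalDegree ((hsupp _).2 ⟨p, hp, rfl⟩)
    rw [Finsupp.sum_fintype _ _ (by simp)] at hle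
    simpa [h] using hle

/-! ### Half Newton polytopes of coded polynomials -/

/-- A linear inequality that is valid on the support of `f` is valid on the doubles of the
sparse terms. -/
theorem two_mul_sum_le_of_mem_sparseTerms {n : ℕ} {f : MvPolynomial (Fin n) ℝ} (w : Fin n → ℤ)
    (k : ℤ) (h : ∀ β ∈ f.support, ∑ i, w i * β i ≤ k) {α : Fin n →₀ ℕ}
    (hα : α ∈ sparseTerms f (termsLE n 0)) : 2 * ∑ i, w i * α i ≤ k := by
  rw [sparseTerms_termsLE_zero] at hα
  let ℓ : (Fin n → ℝ) →ₗ[ℝ] ℝ := ∑ i, (w i : ℝ) • LinearMap.proj i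
  have hℓ : ∀ β : Fin n →₀ ℕ, ℓ (expPoint β) = ((∑ i, w i * β i : ℤ) : ℝ) := fun β => by
    simp [ℓ, expPoint]
  have hsub : expPoint '' (f.support : Set (Fin n →₀ ℕ)) ⊆ {x | ℓ x ≤ k} := by
    rintro _ ⟨β, hβ, rfl⟩
    rw [Set.mem_ofPred_eq, hℓ]
    exact_mod_cast h β hβ
  have hle : ℓ (expPoint (2 • α)) ≤ k :=
    convexHull_min hsub (convex_halfSpace_le ℓ.isLinear _) hα
  rw [two_smul, expPoint_add, map_add, hℓ, ← two_mul] at hle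
  exact_mod_cast hle

/-- The codes of the terms of weight `2` in four variables with weights `2`, `1`, `1`, `1`. -/
def halfCodes : List ℕ := [1000, 200, 110, 101, 20, 11, 2]

theorem mem_halfCodes {a b c d : ℕ} (h : 2 * a + b + c + d = 2) :
    1000 * a + 100 * b + 10 * c + d ∈ halfCodes := by
  have ha : a ≤ 1 := by omega
  have hb : b ≤ 2 := by omega
  have hc : c ≤ 2 := by omega
  obtain rfl : d = 2 - 2 * a - b - c := by omega
  interval_cases a <;> interval_cases b <;> interval_cases c <;> first | omega | decide

/-- The inequalities in `W` are valid on the codes in `L`, and the terms of weight `(2, 2)` whose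
doubles satisfy them have their codes in `G`. -/
def NewtonBounds (L : List (ℕ × ℤ)) (G : List ℕ) (W : List ((Fin 8 → ℤ) × ℤ)) : Prop :=
  (∀ p ∈ L, ∀ w ∈ W, ∑ i, w.1 i * codeDigit p.1 i ≤ w.2) ∧
  ∀ m ∈ halfCodes, ∀ n ∈ halfCodes,
    (∀ w ∈ W, 2 * ∑ i, w.1 i * codeDigit (10000 * m + n) i ≤ w.2) → 10000 * m + n ∈ G

instance (L : List (ℕ × ℤ)) (G : List ℕ) (W : List ((Fin 8 → ℤ) × ℤ)) :
    Decidable (NewtonBounds L G W) :=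
  inferInstanceAs (Decidable ((∀ p ∈ L, _) ∧ ∀ m ∈ halfCodes, _))

/-- The codes in `G` have digits at most `2`, and their doubles are codes in `L`. -/
def DoublesMem (L : List (ℕ × ℤ)) (G : List ℕ) : Prop :=
  ∀ g ∈ G, g < 10 ^ 8 ∧ (∀ i, codeDigit g i ≤ 2) ∧ ∃ p ∈ L, p.1 = g + g

instance (L : List (ℕ × ℤ)) (G : List ℕ) : Decidable (DoublesMem L G) :=
  inferInstanceAs (Decidable (∀ g ∈ G, _))

theorem DoublesMem.ofTermCode_add {L : List (ℕ × ℤ)} {G : List ℕ} (hG : DoublesMem L G)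
    {g h : ℕ} (hg : g ∈ G) (hh : h ∈ G) :
    ofTermCode (g + h) = ofTermCode g + ofTermCode h :=
  _root_.ofTermCode_add (hG g hg).1 (hG h hh).1 fun i => by
    have h1 := (hG g hg).2.1 i
    have h2 := (hG h hh).2.1 i
    omega

/-- The outer bound comes from valid inequalities. The inner bound needs no convex combinations,
because doubles of terms in `G` are support points. -/
theorem sparseTerms_codedPoly {L : List (ℕ × ℤ)} {G : List ℕ} {W : List ((Fin 8 → ℤ) × ℤ)}
    (hL : IsPositiveBihomogeneous L) (hW : NewtonBounds L G W) (hG : DoublesMem L G) :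
    sparseTerms (codedPoly L) (termsLE 8 0) = ofTermCode '' {g | g ∈ G} := by
  have hsupp := fun β => mem_support_codedPoly (β := β) fun p hp => (hL p hp).1
  ext α
  constructor
  · intro hα
    have hle : ∀ (w : Fin 8 → ℤ) (k : ℤ), (∀ p ∈ L, ∑ i, w i * codeDigit p.1 i ≤ k) →
        2 * ∑ i, w i * α i ≤ k := fun w k h =>
      two_mul_sum_le_of_mem_sparseTerms w k (fun β hβ => by
        obtain ⟨p, hp, rfl⟩ := (hsupp β).1 hβ
        exact h p hp) hα
    have hdeg : ∀ p ∈ L, _ := fun p hp => Prod.mk.inj (hL p hp).2.2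
    -- Each bihomogeneity equation is used as two opposite inequalities; together they force weight
    -- `(2, 2)` on `α`, leaving only products of `halfCodes`.
    have e1 := hle ![2, 1, 1, 1, 0, 0, 0, 0] 4 fun p hp => by
      have := (hdeg p hp).1
      simp [Fin.sum_univ_eight]
      omega
    have e2 := hle ![-2, -1, -1, -1, 0, 0, 0, 0] (-4) fun p hp => by
      have := (hdeg p hp).1
      simp [Fin.sum_univ_eight]
      omega
    have e3 := hle ![0, 0, 0, 0, 2, 1, 1, 1] 4 fun p hp => by
      have := (hdeg p hp).2
      simp [Fin.sum_univ_eight]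
      omega
    have e4 := hle ![0, 0, 0, 0, -2, -1, -1, -1] (-4) fun p hp => by
      have := (hdeg p hp).2
      simp [Fin.sum_univ_eight]
      omega
    simp [Fin.sum_univ_eight] at e1 e2 e3 e4
    have hlt : ∀ i, α i < 10 := by
      intro i
      fin_cases i <;> simp <;> omega
    have hcode : termCode α = 10000 * (1000 * α 0 + 100 * α 1 + 10 * α 2 + α 3) +
        (1000 * α 4 + 100 * α 5 + 10 * α 6 + α 7) := by
      simp only [termCode, AddMonoidHom.coe_mk, ZeroHom.coe_mk]
      ring
    refine ⟨termCode α, ?_, ofTermCode_termCode hlt⟩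
    rw [Set.mem_ofPred_eq, hcode]
    refine hW.2 _ (mem_halfCodes (by omega)) _ (mem_halfCodes (by omega)) fun w hw => ?_
    simp only [← hcode, ← ofTermCode_apply, ofTermCode_termCode hlt]
    exact hle w.1 w.2 fun p hp => hW.1 p hp w hw
  · rintro ⟨g, hg, rfl⟩
    obtain ⟨p, hp, hpg⟩ := (hG g hg).2.2
    rw [sparseTerms_termsLE_zero]
    refine subset_convexHull ℝ _ ⟨_, (hsupp _).2 ⟨p, hp, rfl⟩, ?_⟩
    rw [hpg, hG.ofTermCode_add hg hg, two_smul]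

theorem ncard_image_ofTermCode {s : Finset ℕ} (hs : ∀ n ∈ s, n < 10 ^ 8) :
    (ofTermCode '' (s : Set ℕ)).ncard = s.card := by
  rw [Set.InjOn.ncard_image, Set.ncard_coe_finset]
  intro m hm n hn h
  rw [← termCode_ofTermCode (hs m hm), h, termCode_ofTermCode (hs n hn)]

theorem sdpDim_codedPoly {L : List (ℕ × ℤ)} {G : List ℕ} {W : List ((Fin 8 → ℤ) × ℤ)}
    (hL : IsPositiveBihomogeneous L) (hW : NewtonBounds L G W) (hG : DoublesMem L G) :
    sdpDim (codedPoly L) (termsLE 8 0) = G.toFinset.card + 1 := by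
  rw [sdpDim, sparseTerms_codedPoly hL hW hG, termsLE_zero, Set.ncard_singleton,
    ← ncard_image_ofTermCode (s := G.toFinset) fun n hn => (hG n (List.mem_toFinset.1 hn)).1,
    List.coe_toFinset]

/-- The sums of two members of a list of numbers. -/
def pairSums : List ℕ → List ℕ
  | [] => []
  | g :: G => (g :: G).map (g + ·) ++ pairSums G

/-- By commutativity each unordered pair need be listed only once, which shortens the kernel count
of the sumset. -/
theorem toFinset_pairSums (G : List ℕ) : (pairSums G).toFinset = G.toFinset + G.toFinset := by
  induction G with
  | nil => rfl
  | cons g G ih =>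
    ext n
    have h := Finset.ext_iff.1 ih n
    simp only [List.mem_toFinset, Finset.mem_add] at h
    simp only [pairSums, List.mem_toFinset, List.mem_append, h, List.mem_map, Finset.mem_add]
    constructor
    · rintro (⟨a, ha, rfl⟩ | ⟨a, ha, b, hb, rfl⟩)
      exacts [⟨g, List.mem_cons_self, a, ha, rfl⟩,
        ⟨a, List.mem_cons_of_mem _ ha, b, List.mem_cons_of_mem _ hb, rfl⟩]
    · rintro ⟨a, ha, b, hb, rfl⟩
      rcases List.mem_cons.1 ha with rfl | ha'
      · exact Or.inl ⟨b, hb, rfl⟩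
      rcases List.mem_cons.1 hb with rfl | hb'
      · exact Or.inl ⟨a, ha, add_comm _ _⟩
      · exact Or.inr ⟨a, ha', b, hb', rfl⟩

theorem certificateLength_codedPoly {L : List (ℕ × ℤ)} {G : List ℕ}
    {W : List ((Fin 8 → ℤ) × ℤ)}
    (hL : IsPositiveBihomogeneous L) (hW : NewtonBounds L G W) (hG : DoublesMem L G) :
    certificateLength (codedPoly L) (termsLE 8 0) = (pairSums G).toFinset.card := by
  rw [toFinset_pairSums]
  have hsum : ofTermCode '' {g | g ∈ G} + ofTermCode '' {g | g ∈ G} =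
      ofTermCode '' ((G.toFinset + G.toFinset : Finset ℕ) : Set ℕ) := by
    rw [Finset.coe_add, List.coe_toFinset, ← Set.image2_add, ← Set.image2_add,
      Set.image2_image_left, Set.image2_image_right, Set.image_image2]
    exact Set.image2_congr fun g hg h hh => (hG.ofTermCode_add hg hh).symm
  rw [certificateLength, sparseTerms_codedPoly hL hW hG, hsum, ncard_image_ofTermCode]
  intro n hn
  obtain ⟨g, hg, h, hh, rfl⟩ := Finset.mem_add.1 hn
  -- The leading digit is at most `2`, so sums of two codes still have at most eight digits.
  have hlt : ∀ g ∈ G, g < 10 ^ 8 / 2 := fun g hg => by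
    have h0 := (hG g hg).2.1 0
    have h1 := (hG g hg).1
    simp [codeDigit] at h0
    omega
  have h1 := hlt g (List.mem_toFinset.1 hg)
  have h2 := hlt h (List.mem_toFinset.1 hh)
  omega

/-! ### Certificates given by lists of moments -/

/-- The integer that a list of entries assigns to a code (zero if there is none). -/
def entryAt (Y : List (ℕ × ℤ)) (n : ℕ) : ℤ := (Y.lookup n).getD 0

theorem exists_mem_of_entryAt_ne_zero {Y : List (ℕ × ℤ)} {n : ℕ} (h : entryAt Y n ≠ 0) :
    ∃ q ∈ Y, q.1 = n := by
  induction Y with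
  | nil => exact absurd rfl h
  | cons q Y ih =>
    by_cases hq : n = q.1
    · exact ⟨q, List.mem_cons_self, hq.symm⟩
    · have h' : entryAt (q :: Y) n = entryAt Y n := by
        simp only [entryAt, List.lookup, beq_eq_false_iff_ne.2 hq]
      rw [h'] at h
      obtain ⟨q', hq', e⟩ := ih h
      exact ⟨q', List.mem_cons_of_mem _ hq', e⟩

/-- The moment vector with a given list of entries at term codes. -/
noncomputable def codedMoments (Y : List (ℕ × ℤ)) (α : Fin 8 →₀ ℕ) : ℚ :=
  -- Terms with an exponent of `10` or more may share a code with another term; the test sends them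
  -- to zero.
  if ofTermCode (termCode α) = α then entryAt Y (termCode α) else 0

theorem codedMoments_ofTermCode (Y : List (ℕ × ℤ)) {n : ℕ} (hn : n < 10 ^ 8) :
    codedMoments Y (ofTermCode n) = entryAt Y n := by
  rw [codedMoments, termCode_ofTermCode hn, if_pos rfl]

/-- The moments `Y` are indexed by sums of two codes in `G`, they are the entries of the Gram
matrix of the linear forms in `V`, and the linear form is negative at the polynomial with
coefficients `L`. -/
def IsCodedCertificate (L : List (ℕ × ℤ)) (G : List ℕ) (V : List (List (ℕ × ℤ)))
    (Y : List (ℕ × ℤ)) : Prop :=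
  (∀ q ∈ Y, ∃ g ∈ G, ∃ h ∈ G, q.1 = g + h) ∧
  (∀ g ∈ G, ∀ h ∈ G, entryAt Y (g + h) = (V.map fun v => entryAt v g * entryAt v h).sum) ∧
  (L.map fun p => p.2 * entryAt Y p.1).sum < 0

instance (L : List (ℕ × ℤ)) (G : List ℕ) (V : List (List (ℕ × ℤ))) (Y : List (ℕ × ℤ)) :
    Decidable (IsCodedCertificate L G V Y) :=
  inferInstanceAs (Decidable ((∀ q ∈ Y, _) ∧ (∀ g ∈ G, _) ∧ _ < _))

/-- Transfers the integer checks to polynomials: on `G`, addition of codes matches addition of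
exponents, so the Gram identity on codes is the one on moments. -/
theorem isFarkasCertificate_codedMoments {L : List (ℕ × ℤ)} {G : List ℕ}
    {W : List ((Fin 8 → ℤ) × ℤ)} {V : List (List (ℕ × ℤ))} {Y : List (ℕ × ℤ)}
    (hL : IsPositiveBihomogeneous L) (hW : NewtonBounds L G W) (hG : DoublesMem L G)
    (hY : IsCodedCertificate L G V Y) :
    IsFarkasCertificate (codedPoly L) (termsLE 8 0) (codedMoments Y) := by
  rw [IsFarkasCertificate, sparseTerms_codedPoly hL hW hG]
  obtain ⟨hsum, hgram, hneg⟩ := hY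
  refine ⟨fun γ hγ => ?_, fun u hu => ?_, fun v hv0 hv => ?_⟩
  · rw [Function.mem_support, codedMoments, ite_ne_right_iff, Int.cast_ne_zero] at hγ
    obtain ⟨q, hq, hqγ⟩ := exists_mem_of_entryAt_ne_zero hγ.2
    obtain ⟨g, hg, h, hh, hgh⟩ := hsum q hq
    rw [← hγ.1, ← hqγ, hgh, hG.ofTermCode_add hg hh]
    exact Set.add_mem_add ⟨g, hg, rfl⟩ ⟨h, hh, rfl⟩
  · refine momentForm_sq_nonneg _ Finset.univ
      (fun (k : Fin V.length) α => (entryAt V[k] (termCode α) : ℝ)) fun α hα β hβ => ?_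
    obtain ⟨g, hg, rfl⟩ := hu hα
    obtain ⟨h, hh, rfl⟩ := hu hβ
    have hcode : termCode (ofTermCode g + ofTermCode h) = g + h := by
      rw [map_add, termCode_ofTermCode (hG g hg).1, termCode_ofTermCode (hG h hh).1]
    rw [codedMoments, hcode, hG.ofTermCode_add hg hh, if_pos rfl,
      termCode_ofTermCode (hG g hg).1, termCode_ofTermCode (hG h hh).1, hgram g hg h hh,
      ← Fin.sum_univ_fun_getElem]
    push_cast
    rfl
  -- An admissible multiplier is a nonzero constant `c`, and `L(f c²) = c² L(f)`.
  · obtain ⟨c, rfl⟩ := eq_C_of_support_subset hv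
    have hc : c ≠ 0 := fun h => hv0 (by rw [h, MvPolynomial.C_0])
    rw [← MvPolynomial.C_pow, mul_comm, ← MvPolynomial.smul_eq_C_mul, momentForm_smul]
    refine mul_neg_of_pos_of_neg (by positivity) ?_
    have h : momentForm (codedMoments Y) (codedPoly L) =
        ((L.map fun p => p.2 * entryAt Y p.1).sum : ℤ) := by
      change momentLinear _ _ = _
      rw [codedPoly, map_list_sum, List.map_map, Int.cast_list_sum, List.map_map]
      refine congrArg List.sum (List.map_congr_left fun p hp => ?_)
      simp [momentLinear_monomial, codedMoments_ofTermCode Y (hL p hp).2.1]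
    rw [h]
    exact_mod_cast hneg

/-! ### The three polynomials -/

/-- The coefficients of `mcpPoly 1 2`, at the codes of its terms. -/
def coeffsOneTwo : List (ℕ × ℤ) :=
  [(20002000, 24), (20001020, 24), (20001002, 36), (20000220, 4), (20000202, 2), (20000040, 8),
   (20000022, 20), (20000004, 14), (10202000, 24), (10201020, 8), (10201002, 28), (10200022, 4),
   (10200004, 8), (10022000, 36), (10021020, 28), (10021002, 52), (10020220, 4), (10020202, 4),
   (10020040, 8), (10020022, 24), (10020004, 20), (2202000, 4), (2201002, 4), (2200004, 1),
   (2022000, 2), (2021002, 4), (2020022, 1), (2020004, 2), (402000, 8), (401002, 8), (400004, 2),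
   (222000, 20), (221020, 4), (221002, 24), (220202, 1), (220022, 4), (220004, 8), (42000, 14),
   (41020, 8), (41002, 20), (40220, 1), (40202, 2), (40040, 2), (40022, 8), (40004, 8)]

/-- The codes of the sparse terms of `mcpPoly 1 2`. -/
def sparseOneTwo : List ℕ :=
  [10001000, 10000110, 10000101, 10000020, 10000011, 10000002, 1101000, 1100002, 1011000,
   1010011, 1010002, 201000, 200002, 111000, 110101, 110011, 110002, 21000, 20110, 20101, 20020,
   20011, 20002]

/-- The coefficients of `mcpPoly 2 2`, at the codes of its terms. -/
def coeffsTwoTwo : List (ℕ × ℤ) :=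
  [(20002000, 48), (20001200, 24), (20001020, 48), (20001002, 72), (20000400, 4), (20000220, 16),
   (20000202, 20), (20000040, 16), (20000022, 40), (20000004, 28), (12002000, 24), (12001200, 8),
   (12001020, 8), (12001002, 28), (12000202, 4), (12000022, 4), (12000004, 8), (10202000, 48),
   (10201200, 8), (10201020, 16), (10201002, 56), (10200202, 4), (10200022, 8), (10200004, 16),
   (10022000, 72), (10021200, 28), (10021020, 56), (10021002, 104), (10020400, 4),
   (10020220, 16), (10020202, 24), (10020040, 16), (10020022, 48), (10020004, 40), (4002000, 4),
   (4001002, 4), (4000004, 1), (2202000, 16), (2201002, 16), (2200004, 4), (2022000, 20),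
   (2021200, 4), (2021020, 4), (2021002, 24), (2020202, 2), (2020022, 4), (2020004, 8),
   (402000, 16), (401002, 16), (400004, 4), (222000, 40), (221200, 4), (221020, 8), (221002, 48),
   (220202, 4), (220022, 8), (220004, 16), (42000, 28), (41200, 8), (41020, 16), (41002, 40),
   (40400, 1), (40220, 4), (40202, 8), (40040, 4), (40022, 16), (40004, 16)]

/-- The codes of the sparse terms of `mcpPoly 2 2`. -/
def sparseTwoTwo : List ℕ :=
  [10001000, 10000200, 10000110, 10000101, 10000020, 10000011, 10000002, 2001000, 2000002,
   1101000, 1100002, 1011000, 1010101, 1010011, 1010002, 201000, 200002, 111000, 110101, 110011,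
   110002, 21000, 20200, 20110, 20101, 20020, 20011, 20002]

/-- The coefficients of `mcpPoly 2 3`, at the codes of its terms. -/
def coeffsTwoThree : List (ℕ × ℤ) :=
  [(20002000, 24), (20001200, 12), (20001020, 24), (20001002, 48), (20000400, 2), (20000220, 8),
   (20000202, 14), (20000040, 8), (20000022, 28), (20000004, 24), (12002000, 12), (12001200, 4),
   (12001020, 4), (12001002, 24), (12000202, 4), (12000022, 8), (12000004, 12), (10202000, 24),
   (10201200, 4), (10201020, 8), (10201002, 48), (10200202, 8), (10200022, 16), (10200004, 24),
   (10022000, 48), (10021200, 24), (10021020, 48), (10021002, 96), (10020400, 4), (10020220, 16),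
   (10020202, 28), (10020040, 16), (10020022, 56), (10020004, 48), (4002000, 2), (4001002, 4),
   (4000022, 1), (4000004, 2), (2202000, 8), (2201002, 16), (2200202, 1), (2200022, 4),
   (2200004, 8), (2022000, 14), (2021200, 4), (2021020, 8), (2021002, 28), (2020220, 1),
   (2020202, 4), (2020040, 2), (2020022, 12), (2020004, 14), (402000, 8), (401002, 16),
   (400202, 2), (400022, 4), (400004, 8), (222000, 28), (221200, 8), (221020, 16), (221002, 56),
   (220400, 1), (220220, 4), (220202, 12), (220040, 4), (220022, 24), (220004, 28), (42000, 24),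
   (41200, 12), (41020, 24), (41002, 48), (40400, 2), (40220, 8), (40202, 14), (40040, 8),
   (40022, 28), (40004, 24)]

/-- The codes of the sparse terms of `mcpPoly 2 3`. -/
def sparseTwoThree : List ℕ :=
  [10001000, 10000200, 10000110, 10000101, 10000020, 10000011, 10000002, 2001000, 2000011,
   2000002, 1101000, 1100101, 1100011, 1100002, 1011000, 1010110, 1010101, 1010020, 1010011,
   1010002, 201000, 200101, 200011, 200002, 111000, 110200, 110110, 110101, 110020, 110011,
   110002, 21000, 20200, 20110, 20101, 20020, 20011, 20002]

/-- Linear forms whose Gram matrix gives a certificate for `mcpPoly 1 2`. -/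
def squaresOneTwo : List (List (ℕ × ℤ)) :=
  [[(10001000, 8), (10000020, -4), (10000002, -4), (201000, -4), (200002, 2), (21000, -4),
    (20020, 2), (20002, 2)],
   [(10000020, 1), (201000, -1), (200002, 2), (20020, -2)], [(10000011, 4), (20011, -2)],
   [(111000, 4), (110002, -2)]]

/-- The moments of a certificate for `mcpPoly 1 2`. -/
def momentsOneTwo : List (ℕ × ℤ) :=
  [(20002000, 64), (20001020, -32), (20001002, -32), (20000040, 17), (20000022, 16),
   (20000004, 16), (10202000, -32), (10201020, 15), (10201002, 16), (10200022, -6),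
   (10200004, -8), (10022000, -32), (10021020, 16), (10021002, 16), (10020040, -10),
   (10020022, -8), (10020004, -8), (402000, 17), (401002, -10), (400004, 8), (222000, 16),
   (221020, -6), (221002, -8), (220004, 4), (42000, 16), (41020, -8), (41002, -8), (40040, 8),
   (40022, 4), (40004, 4)]

/-- Linear forms whose Gram matrix gives a certificate for `mcpPoly 2 2` and `mcpPoly 2 3`. -/
def squaresTwo : List (List (ℕ × ℤ)) :=
  [[(10001000, 1), (10000200, 1), (10000020, -1), (2001000, -3)],
   [(10001000, 1), (10000200, -1), (10000020, -1), (201000, -1)]]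

/-- The moments of a certificate for `mcpPoly 2 2` and `mcpPoly 2 3`. -/
def momentsTwo : List (ℕ × ℤ) :=
  [(20002000, 2), (20001020, -2), (20000400, 2), (20000040, 2), (12002000, -3), (12001200, -3),
   (12001020, 3), (10202000, -1), (10201200, 1), (10201020, 1), (4002000, 9), (402000, 1)]

/-- Valid inequalities for the Newton polytope of `mcpPoly 1 2`. -/
def boundsOneTwo : List ((Fin 8 → ℤ) × ℤ) :=
  [(![0, 2, 1, 0, 0, 2, 1, 0], 6), (![0, 0, 1, 0, 0, 0, 1, 0], 4)]

/-- Valid inequalities for the Newton polytope of `mcpPoly 2 2`. -/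
def boundsTwoTwo : List ((Fin 8 → ℤ) × ℤ) :=
  [(![0, 1, 1, 0, 0, 1, 1, 0], 4)]

/-- Valid inequalities for the Newton polytope of `mcpPoly 2 3`. -/
def boundsTwoThree : List ((Fin 8 → ℤ) × ℤ) :=
  [(![0, 2, 1, -1, 0, 2, 1, -1], 8), (![0, 0, 1, 0, 0, 0, 1, 0], 6)]

/-! ### Verification of expansions, polytopes and certificates -/

theorem mcpPoly_one_two : mcpPoly 1 2 = codedPoly coeffsOneTwo := by
  simp [codedPoly, coeffsOneTwo, monomial_ofTermCode, Fin.prod_univ_eight, codeDigit, mcpPoly,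
    mcpForm, mcpPerm_eq_sum, Fin.sum_univ_four, mcpStep, mcpColumn]
  ring

theorem isPositiveBihomogeneous_one_two : IsPositiveBihomogeneous coeffsOneTwo := by
  decide +kernel

theorem newtonBounds_one_two : NewtonBounds coeffsOneTwo sparseOneTwo boundsOneTwo := by
  decide +kernel

theorem doublesMem_one_two : DoublesMem coeffsOneTwo sparseOneTwo := by
  decide +kernel

/-- The linear form takes the value `-8` at the polynomial. -/
theorem isCodedCertificate_one_two :
    IsCodedCertificate coeffsOneTwo sparseOneTwo squaresOneTwo momentsOneTwo := by
  decide +kernel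

theorem mcpPoly_two_two : mcpPoly 2 2 = codedPoly coeffsTwoTwo := by
  simp [codedPoly, coeffsTwoTwo, monomial_ofTermCode, Fin.prod_univ_eight, codeDigit, mcpPoly,
    mcpForm, mcpPerm_eq_sum, Fin.sum_univ_four, mcpStep, mcpColumn]
  ring

theorem isPositiveBihomogeneous_two_two : IsPositiveBihomogeneous coeffsTwoTwo := by
  decide +kernel

theorem newtonBounds_two_two : NewtonBounds coeffsTwoTwo sparseTwoTwo boundsTwoTwo := by
  decide +kernel

theorem doublesMem_two_two : DoublesMem coeffsTwoTwo sparseTwoTwo := by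
  decide +kernel

/-- The value is `-4`. All nonzero moments sit at terms free of `d` and `d'`, so only the
restriction to `d = d' = 0` matters. -/
theorem isCodedCertificate_two_two :
    IsCodedCertificate coeffsTwoTwo sparseTwoTwo squaresTwo momentsTwo := by
  decide +kernel

theorem mcpPoly_two_three : mcpPoly 2 3 = codedPoly coeffsTwoThree := by
  simp [codedPoly, coeffsTwoThree, monomial_ofTermCode, Fin.prod_univ_eight, codeDigit, mcpPoly,
    mcpForm, mcpPerm_eq_sum, Fin.sum_univ_four, mcpStep, mcpColumn]
  ring

theorem isPositiveBihomogeneous_two_three : IsPositiveBihomogeneous coeffsTwoThree := by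
  decide +kernel

theorem newtonBounds_two_three : NewtonBounds coeffsTwoThree sparseTwoThree boundsTwoThree := by
  decide +kernel

theorem doublesMem_two_three : DoublesMem coeffsTwoThree sparseTwoThree := by
  decide +kernel

/-- At `d = d' = 0` the polynomial `p_{2,2}` becomes twice `p_{2,3}`, which is why the same moments
serve both; here the value is `-2`. -/
theorem isCodedCertificate_two_three :
    IsCodedCertificate coeffsTwoThree sparseTwoThree squaresTwo momentsTwo := by
  decide +kernel

theorem conclusions_of_codes {f : MvPolynomial (Fin 8) ℝ} {L : List (ℕ × ℤ)} {G : List ℕ}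
    {W : List ((Fin 8 → ℤ) × ℤ)} {V : List (List (ℕ × ℤ))} {Y : List (ℕ × ℤ)}
    (hf : f = codedPoly L) (hL : IsPositiveBihomogeneous L)
    (h8 : ∃ p ∈ L, ∑ i, codeDigit p.1 i = 8) (hW : NewtonBounds L G W) (hG : DoublesMem L G)
    (hY : IsCodedCertificate L G V Y) :
    f.totalDegree = 8 ∧
      (∃ y : (Fin 8 →₀ ℕ) → ℚ, IsFarkasCertificate f (termsLE 8 0) y) ∧
      ¬ IsSumSq f ∧
      algebraMap (MvPolynomial (Fin 8) ℝ) (FractionRing (MvPolynomial (Fin 8) ℝ)) f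
        ∉ RSOS (termsLE 8 0) := by
  subst hf
  have hcert := isFarkasCertificate_codedMoments hL hW hG hY
  exact ⟨totalDegree_codedPoly hL h8, ⟨_, hcert⟩, hcert.not_isSumSq,
    fun h => hcert.not_isSumSq (isSumSq_of_mem_RSOS h)⟩

theorem mainTheorem9 :
    (∀ f ∈ ({mcpPoly 1 2, mcpPoly 2 2, mcpPoly 2 3} : Set (MvPolynomial (Fin 8) ℝ)),
      f.totalDegree = 8 ∧
      (∃ y : (Fin 8 →₀ ℕ) → ℚ, IsFarkasCertificate f (termsLE 8 0) y) ∧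
      ¬ IsSumSq f ∧
      algebraMap (MvPolynomial (Fin 8) ℝ) (FractionRing (MvPolynomial (Fin 8) ℝ)) f
        ∉ RSOS (termsLE 8 0)) ∧
    (sdpDim (mcpPoly 1 2) (termsLE 8 0) = 24 ∧
      certificateLength (mcpPoly 1 2) (termsLE 8 0) = 189) ∧
    (sdpDim (mcpPoly 2 2) (termsLE 8 0) = 29 ∧
      certificateLength (mcpPoly 2 2) (termsLE 8 0) = 255) ∧
    (sdpDim (mcpPoly 2 3) (termsLE 8 0) = 39 ∧
      certificateLength (mcpPoly 2 3) (termsLE 8 0) = 372) := by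
  refine ⟨?_, ⟨?_, ?_⟩, ⟨?_, ?_⟩, ⟨?_, ?_⟩⟩
  · rintro f (rfl | rfl | rfl)
    -- In all three cases degree `8` is attained, for example, at `d⁴ d'⁴`, with code `40004`.
    · exact conclusions_of_codes mcpPoly_one_two isPositiveBihomogeneous_one_two (by decide +kernel)
        newtonBounds_one_two doublesMem_one_two isCodedCertificate_one_two
    · exact conclusions_of_codes mcpPoly_two_two isPositiveBihomogeneous_two_two (by decide +kernel)
        newtonBounds_two_two doublesMem_two_two isCodedCertificate_two_two
    · exact conclusions_of_codes mcpPoly_two_three isPositiveBihomogeneous_two_three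
        (by decide +kernel) newtonBounds_two_three doublesMem_two_three isCodedCertificate_two_three
  · rw [mcpPoly_one_two, sdpDim_codedPoly isPositiveBihomogeneous_one_two
      newtonBounds_one_two doublesMem_one_two]
    decide +kernel
  · rw [mcpPoly_one_two, certificateLength_codedPoly isPositiveBihomogeneous_one_two
      newtonBounds_one_two doublesMem_one_two]
    decide +kernel
  · rw [mcpPoly_two_two, sdpDim_codedPoly isPositiveBihomogeneous_two_two
      newtonBounds_two_two doublesMem_two_two]
    decide +kernel
  · rw [mcpPoly_two_two, certificateLength_codedPoly isPositiveBihomogeneous_two_two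
      newtonBounds_two_two doublesMem_two_two]
    decide +kernel
  · rw [mcpPoly_two_three, sdpDim_codedPoly isPositiveBihomogeneous_two_three
      newtonBounds_two_three doublesMem_two_three]
    decide +kernel
  · rw [mcpPoly_two_three, certificateLength_codedPoly isPositiveBihomogeneous_two_three
      newtonBounds_two_three doublesMem_two_three]
    decide +kernel
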